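/- Let $G$ be a graph on $n$ vertices with adjacency matrix $A$ and diagonal matrix of vertex degrees $D$. For $q\in\mathbb{R}$, the $q$-Laplacian of $G$ is the real symmetric $n\times n$ matrix $\mathcal{L}_G^q = I + q^2(D-I) - qA$. Write $\lambda_1(\mathcal{L}_G^q)\ge\lambda_2(\mathcal{L}_G^q)\ge\cdots\ge\lambda_n(\mathcal{L}_G^q)$ for its eigenvalues, counted with multiplicity, and for $n \ge 2$ let $\lambda_a(\mathcal{L}_G^q)=\lambda_{n-1}(\mathcal{L}_G^q)$ be the second smallest one. Let $n>2$. Then for every tree $T$ on $n$ vertices and every $q\in\mathbb{R}$, $$\lambda_a(\mathcal{L}_T^q)\le 1.$$ Moreover, if $S_n$ is the star on $n$ vertices (one vertex adjacent to all the others, and no other edges), then $\lambda_a(\mathcal{L}_{S_n}^q)=1$ for every $q\in\mathbb{R}$. -/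

import Mathlib

noncomputable section

/-- The `q`-Laplacian `I + q² (D - I) - q A` of a finite simple graph, where `D` is the diagonal
matrix of vertex degrees and `A` is the adjacency matrix. -/
def qLaplacian {V : Type*} [Fintype V] [DecidableEq V] (G : SimpleGraph V) [DecidableRel G.Adj]
    (q : ℝ) : Matrix V V ℝ :=
  1 + q ^ 2 • (G.degMatrix ℝ - 1) - q • G.adjMatrix ℝ

theorem isHermitian_qLaplacian {V : Type*} [Fintype V] [DecidableEq V] (G : SimpleGraph V)
    [DecidableRel G.Adj] (q : ℝ) : (qLaplacian G q).IsHermitian := by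
  have hD : (G.degMatrix ℝ).transpose = G.degMatrix ℝ := G.isSymm_degMatrix ℝ
  rw [Matrix.IsHermitian, Matrix.conjTranspose_eq_transpose_of_trivial]
  simp [qLaplacian, hD]

/-- The second smallest eigenvalue `λ_{n-1}` of a real symmetric `n × n` matrix with eigenvalues
`λ_1 ≥ λ_2 ≥ ⋯ ≥ λ_n`, counted with multiplicity. Mathlib's `eigenvalues₀` lists them in
decreasing order, starting from the index `0`. -/
def secondSmallestEigenvalue {V : Type*} [Fintype V] [DecidableEq V] (M : Matrix V V ℝ)
    (hM : M.IsHermitian) (hV : 2 ≤ Fintype.card V) : ℝ :=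
  hM.eigenvalues₀ ⟨Fintype.card V - 2, Nat.sub_lt (by omega) (by omega)⟩

end

/-! On a leaf the diagonal entry of the `q`-Laplacian is `1` for every `q`, so vectors supported on
pairwise nonadjacent leaves have Rayleigh quotient `1`. A tree with `n > 2` vertices has two
nonadjacent leaves, and Courant–Fischer on the plane they span bounds `λ_{n-1}` above by `1`. In a
star all noncentral vertices are such leaves, and their span, of dimension `n - 1`, gives the lower
bound. -/

open Matrix

namespace Matrix.IsHermitian

variable {V : Type*} [Fintype V] [DecidableEq V] {M : Matrix V V ℝ}

/-- The coordinates of real vectors with respect to an orthonormal eigenbasis of a real symmetric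
matrix, indexed by `Fin (Fintype.card V)` as `eigenvalues₀` is. -/
noncomputable def eigencoord (hM : M.IsHermitian) (i : Fin (Fintype.card V)) :
    (V → ℝ) →ₗ[ℝ] ℝ :=
  dotProductBilin ℝ ℝ (hM.eigenvectorBasis (Fintype.equivOfCardEq (Fintype.card_fin _) i)).ofLp

theorem sum_sq_eigencoord (hM : M.IsHermitian) (x : V → ℝ) :
    ∑ i, hM.eigencoord i x ^ 2 = x ⬝ᵥ x := by
  have h := hM.eigenvectorBasis.sum_sq_inner_right (WithLp.toLp 2 x)
  rw [← real_inner_self_eq_norm_sq, EuclideanSpace.inner_eq_star_dotProduct,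
    ← Equiv.sum_comp (Fintype.equivOfCardEq (Fintype.card_fin _))] at h
  simpa [EuclideanSpace.inner_eq_star_dotProduct, eigencoord, dotProduct_comm] using h

theorem eigencoord_mulVec (hM : M.IsHermitian) (i : Fin (Fintype.card V)) (x : V → ℝ) :
    hM.eigencoord i (M *ᵥ x) = hM.eigenvalues₀ i * hM.eigencoord i x := by
  have hT : Mᵀ = M := by simpa [IsHermitian, conjTranspose_eq_transpose_of_trivial] using hM
  have h := hM.mulVec_eigenvectorBasis (Fintype.equivOfCardEq (Fintype.card_fin _) i)
  simp only [eigencoord, dotProductBilin_apply_apply]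
  rw [dotProduct_mulVec, ← mulVec_transpose, hT, h, smul_dotProduct]
  simp [eigenvalues]

theorem dotProduct_mulVec_eq_sum (hM : M.IsHermitian) (x : V → ℝ) :
    x ⬝ᵥ M *ᵥ x = ∑ i, hM.eigenvalues₀ i * hM.eigencoord i x ^ 2 := by
  have h := hM.eigenvectorBasis.sum_inner_mul_inner (WithLp.toLp 2 x) (WithLp.toLp 2 (M *ᵥ x))
  rw [← Equiv.sum_comp (Fintype.equivOfCardEq (Fintype.card_fin _))] at h
  simp only [EuclideanSpace.inner_eq_star_dotProduct, star_trivial] at h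
  rw [dotProduct_comm x, ← h]
  refine Finset.sum_congr rfl fun i _ => ?_
  have h₂ := hM.eigencoord_mulVec i x
  simp only [eigencoord, dotProductBilin_apply_apply] at h₂ ⊢
  rw [dotProduct_comm (M *ᵥ x), h₂]
  ring

/-- A subspace whose dimension exceeds the number of indices in `s` contains a nonzero vector
whose eigencoordinates in `s` vanish. -/
theorem exists_ne_zero_eigencoord_eq_zero (hM : M.IsHermitian) (W : Submodule ℝ (V → ℝ))
    (s : Finset (Fin (Fintype.card V))) (hs : s.card < Module.finrank ℝ W) :
    ∃ x ∈ W, x ≠ 0 ∧ ∀ i ∈ s, hM.eigencoord i x = 0 := by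
  let f : W →ₗ[ℝ] (s → ℝ) := LinearMap.pi fun i => hM.eigencoord i ∘ₗ W.subtype
  have hf : LinearMap.ker f ≠ ⊥ := LinearMap.ker_ne_bot_of_finrank_lt (by simpa using hs)
  obtain ⟨x, hx, hx₀⟩ := (Submodule.ne_bot_iff _).1 hf
  exact ⟨x, x.2, by simpa using hx₀, fun i hi => congrFun (LinearMap.mem_ker.1 hx) ⟨i, hi⟩⟩

/-- The upper bound in the Courant–Fischer theorem. -/
theorem eigenvalues₀_le_of_finrank (hM : M.IsHermitian) (k : Fin (Fintype.card V)) (c : ℝ)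
    (W : Submodule ℝ (V → ℝ)) (hW : Fintype.card V ≤ k + Module.finrank ℝ W)
    (h : ∀ x ∈ W, x ⬝ᵥ M *ᵥ x ≤ c * (x ⬝ᵥ x)) : hM.eigenvalues₀ k ≤ c := by
  -- Only indices `i ≤ k` survive, and their eigenvalues are at least the `k`-th one.
  obtain ⟨x, hxW, hx₀, hx⟩ := hM.exists_ne_zero_eigencoord_eq_zero W (Finset.Ioi k)
    (by rw [Fin.card_Ioi]; omega)
  have hle : hM.eigenvalues₀ k * (x ⬝ᵥ x) ≤ x ⬝ᵥ M *ᵥ x := by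
    rw [dotProduct_mulVec_eq_sum hM, ← hM.sum_sq_eigencoord, Finset.mul_sum]
    refine Finset.sum_le_sum fun i _ => ?_
    rcases le_or_gt i k with hi | hi
    · exact mul_le_mul_of_nonneg_right (hM.eigenvalues₀_antitone hi) (sq_nonneg _)
    · simp [hx i (Finset.mem_Ioi.2 hi)]
  have hpos : 0 < x ⬝ᵥ x := by simpa using dotProduct_star_self_pos_iff.2 hx₀
  exact le_of_mul_le_mul_right (hle.trans (h x hxW)) hpos

/-- The lower bound in the Courant–Fischer theorem. -/
theorem le_eigenvalues₀_of_finrank (hM : M.IsHermitian) (k : Fin (Fintype.card V)) (c : ℝ)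
    (W : Submodule ℝ (V → ℝ)) (hW : k < Module.finrank ℝ W)
    (h : ∀ x ∈ W, c * (x ⬝ᵥ x) ≤ x ⬝ᵥ M *ᵥ x) : c ≤ hM.eigenvalues₀ k := by
  obtain ⟨x, hxW, hx₀, hx⟩ := hM.exists_ne_zero_eigencoord_eq_zero W (Finset.Iio k)
    (by rwa [Fin.card_Iio])
  have hle : x ⬝ᵥ M *ᵥ x ≤ hM.eigenvalues₀ k * (x ⬝ᵥ x) := by
    rw [dotProduct_mulVec_eq_sum hM, ← hM.sum_sq_eigencoord, Finset.mul_sum]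
    refine Finset.sum_le_sum fun i _ => ?_
    rcases le_or_gt k i with hi | hi
    · exact mul_le_mul_of_nonneg_right (hM.eigenvalues₀_antitone hi) (sq_nonneg _)
    · simp [hx i (Finset.mem_Iio.2 hi)]
  have hpos : 0 < x ⬝ᵥ x := by simpa using dotProduct_star_self_pos_iff.2 hx₀
  exact le_of_mul_le_mul_right ((h x hxW).trans hle) hpos

end Matrix.IsHermitian

namespace SimpleGraph

variable {V : Type*} [Fintype V] [DecidableEq V]

/-- In a connected graph with more than two vertices, leaves are pairwise nonadjacent. -/
theorem Connected.not_adj_of_degree_eq_one {G : SimpleGraph V} [DecidableRel G.Adj]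
    (hG : G.Connected) (hV : 2 < Fintype.card V) {u v : V} (hu : G.degree u = 1)
    (hv : G.degree v = 1) : ¬ G.Adj u v := by
  intro huv
  -- If adjacent, `u` and `v` are each other's only neighbour, so no walk from `u` leaves `{u, v}`
  -- to reach a third vertex `w`.
  obtain ⟨w, hw⟩ := Finset.exists_mem_notMem_of_card_lt_card
    (s := {u, v}) (t := Finset.univ) (by exact Finset.card_le_two.trans_lt hV)
  refine hw.2 ?_
  have hr := (reachable_iff_reflTransGen u w).1 (hG.preconnected u w)
  clear hw
  induction hr with
  | refl => simp
  | tail _ hadj ih =>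
    obtain ⟨a, _, ha⟩ := degree_eq_one_iff_existsUnique_adj.1 hu
    obtain ⟨b, _, hb⟩ := degree_eq_one_iff_existsUnique_adj.1 hv
    grind [SimpleGraph.adj_comm]

/-- A vector supported on pairwise nonadjacent leaves has Rayleigh quotient `1` for the
`q`-Laplacian. -/
theorem dotProduct_qLaplacian_mulVec_eq (G : SimpleGraph V) [DecidableRel G.Adj] (q : ℝ)
    (x : V → ℝ) (hdeg : ∀ i, x i ≠ 0 → G.degree i = 1)
    (hadj : ∀ i j, x i ≠ 0 → x j ≠ 0 → ¬ G.Adj i j) :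
    x ⬝ᵥ qLaplacian G q *ᵥ x = x ⬝ᵥ x := by
  have hD : x ⬝ᵥ G.degMatrix ℝ *ᵥ x = x ⬝ᵥ x := by
    refine Finset.sum_congr rfl fun i _ => ?_
    by_cases hi : x i = 0
    · simp [hi]
    · simp [degMatrix, mulVec_diagonal, hdeg i hi]
  have hA : x ⬝ᵥ G.adjMatrix ℝ *ᵥ x = 0 := by
    refine Finset.sum_eq_zero fun i _ => ?_
    by_cases hi : x i = 0
    · simp [hi]
    · rw [adjMatrix_mulVec_apply, Finset.sum_eq_zero, mul_zero]
      intro j hj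
      by_contra hj₀
      exact hadj i j hi hj₀ (by simpa using hj)
  simp [qLaplacian, add_mulVec, sub_mulVec, smul_mulVec, hD, hA]

end SimpleGraph

theorem secondSmallestEigenvalue_qLaplacian_le_one {V : Type*} [Fintype V] [DecidableEq V]
    (hV : 2 < Fintype.card V) (q : ℝ) (T : SimpleGraph V) [DecidableRel T.Adj] (hT : T.IsTree) :
    secondSmallestEigenvalue (qLaplacian T q) (isHermitian_qLaplacian T q) hV.le ≤ 1 := by
  have : Nontrivial V := Fintype.one_lt_card_iff_nontrivial.1 (by omega)
  obtain ⟨u, v, huv, hu, hv⟩ := hT.exists_ne_and_degree_eq_one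
  have hadj := hT.1.not_adj_of_degree_eq_one hV hu hv
  let e : Fin 2 → V := ![u, v]
  have he : Function.Injective e := by
    intro i j hij
    fin_cases i <;> fin_cases j <;> simp_all [e]
  have hli : LinearIndependent ℝ fun i => Pi.basisFun ℝ V (e i) :=
    (Pi.basisFun ℝ V).linearIndependent.comp e he
  refine (isHermitian_qLaplacian T q).eigenvalues₀_le_of_finrank _ 1
    (Submodule.span ℝ (Set.range fun i => Pi.basisFun ℝ V (e i))) ?_ ?_
  · rw [finrank_span_eq_card hli, Fintype.card_fin]
    -- The zero-based index of `λ_{n-1}` is `n - 2`, so a plane is just large enough.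
    exact Nat.sub_add_cancel hV.le |>.ge
  · intro x hx
    have hsupp : ∀ i, x i ≠ 0 → i = u ∨ i = v := by
      obtain ⟨a, rfl⟩ := (Submodule.mem_span_range_iff_exists_fun ℝ).1 hx
      intro i hi
      contrapose! hi
      simp [e, hi.1, hi.2]
    rw [one_mul, T.dotProduct_qLaplacian_mulVec_eq q x]
    · intro i hi
      rcases hsupp i hi with rfl | rfl <;> assumption
    · intro i j hi hj
      have hadj' : ¬ T.Adj v u := fun h => hadj h.symm
      rcases hsupp i hi with rfl | rfl <;> rcases hsupp j hj with rfl | rfl <;>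
        first | assumption | exact T.irrefl

theorem one_le_secondSmallestEigenvalue_qLaplacian_starGraph {V : Type*} [Fintype V]
    [DecidableEq V] (hV : 2 ≤ Fintype.card V) (q : ℝ) (c : V) :
    1 ≤ secondSmallestEigenvalue (qLaplacian (SimpleGraph.starGraph c) q)
      (isHermitian_qLaplacian (SimpleGraph.starGraph c) q) hV := by
  refine (isHermitian_qLaplacian _ q).le_eigenvalues₀_of_finrank _ 1
    (LinearMap.ker (LinearMap.proj (R := ℝ) (φ := fun _ : V => ℝ) c)) ?_ ?_
  -- The hyperplane `x c = 0` has dimension `n - 1`, exceeding the index `n - 2`.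
  · have h := LinearMap.finrank_range_add_finrank_ker
      (LinearMap.proj (R := ℝ) (φ := fun _ : V => ℝ) c)
    rw [LinearMap.range_eq_top.2 (LinearMap.proj_surjective c), finrank_top] at h
    simp only [Module.finrank_self, Module.finrank_fintype_fun_eq_card] at h
    simp only
    omega
  · intro x hx
    have hx : x c = 0 := hx
    have hne : ∀ i, x i ≠ 0 → i ≠ c := by rintro _ hi rfl; exact hi hx
    rw [one_mul, SimpleGraph.dotProduct_qLaplacian_mulVec_eq _ q x]
    · exact fun i hi => SimpleGraph.degree_starGraph_of_ne_center (hne i hi)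
    · intro i j hi hj
      simp [hne i hi, hne j hj]

theorem mainTheorem5 {V : Type*} [Fintype V] [DecidableEq V] (hV : 2 < Fintype.card V) (q : ℝ) :
    (∀ (T : SimpleGraph V) [DecidableRel T.Adj], T.IsTree →
      secondSmallestEigenvalue (qLaplacian T q) (isHermitian_qLaplacian T q) hV.le ≤ 1) ∧
    (∀ c : V,
      secondSmallestEigenvalue (qLaplacian (SimpleGraph.starGraph c) q)
        (isHermitian_qLaplacian (SimpleGraph.starGraph c) q) hV.le = 1) :=
  ⟨fun T _ hT => secondSmallestEigenvalue_qLaplacian_le_one hV q T hT, fun c =>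
    le_antisymm
      (secondSmallestEigenvalue_qLaplacian_le_one hV q _ (SimpleGraph.isTree_starGraph c))
      (one_le_secondSmallestEigenvalue_qLaplacian_starGraph hV.le q c)⟩
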